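/- Let $D$ be an integral domain with quotient field $K$. An ideal of a domain is invertible if it is invertible as a fractional ideal; an MNI ideal is an ideal that is maximal among the non-invertible ideals (so the zero ideal is allowed). A domain is an MPD domain if it has a unique MNI ideal $Q$ and every nonzero non-invertible ideal equals $JQ$ for some invertible (integral) ideal $J$. The domain $D$ is h-local if each nonzero ideal of $D$ is contained in only finitely many maximal ideals and each nonzero prime ideal is contained in a unique maximal ideal. The domain $D$ is a GMPD (globalized multiplicatively pinched-Dedekind) domain if it is h-local and $D_M$ is an MPD domain for every maximal ideal $M$ of $D$. For a domain $A$ with quotient field $K$, let $\mathcal{O}(A)$ be the set of overrings of $A$, that is, of subrings of $K$ containing $A$, and let $\mathcal{O}_{ql}(A)\subseteq\mathcal{O}(A)$ be the set of those overrings that are quasi-local (have exactly one maximal ideal). If $D$ is a GMPD domain, then $$\mathcal{O}_{ql}(D)=\bigcup_{M\in \mathrm{Max}(D)}\mathcal{O}(D_{M}),$$ where each localization $D_M=\{a/s : a\in D,\ s\in D\setminus M\}$ is regarded as a subring of $K$. -/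

import Mathlib

open scoped nonZeroDivisors

/-- An (integral) ideal `I` of a domain `D` is invertible if it is invertible as a fractional ideal
of `D`, i.e. if `I * J = D` for some fractional ideal `J`. -/
def IsInvertibleIdeal {D : Type*} [CommRing D] [IsDomain D] (I : Ideal D) : Prop :=
  IsUnit (I : FractionalIdeal D⁰ (FractionRing D))

/-- An MNI ideal of `D`: an ideal which is maximal among the non-invertible ideals of `D`. The zero
ideal is non-invertible, and it is the MNI ideal of a Dedekind domain. -/
def IsMNIIdeal {D : Type*} [CommRing D] [IsDomain D] (Q : Ideal D) : Prop :=
  Maximal (fun I : Ideal D => ¬ IsInvertibleIdeal I) Q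

/-- MPD (multiplicatively pinched-Dedekind) domain: there is a unique MNI ideal `Q`, and every
nonzero non-invertible ideal is `J * Q` for some invertible (integral) ideal `J`. -/
def IsMPDDomain (D : Type*) [CommRing D] [IsDomain D] : Prop :=
  ∃ Q : Ideal D, IsMNIIdeal Q ∧ (∀ Q' : Ideal D, IsMNIIdeal Q' → Q' = Q) ∧
    ∀ I : Ideal D, I ≠ ⊥ → ¬ IsInvertibleIdeal I →
      ∃ J : Ideal D, IsInvertibleIdeal J ∧ I = J * Q

/-- h-local domain: each nonzero ideal lies in only finitely many maximal ideals, and each nonzero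
prime ideal lies in a unique maximal ideal. -/
def IsHLocalDomain (D : Type*) [CommRing D] [IsDomain D] : Prop :=
  (∀ I : Ideal D, I ≠ ⊥ → {M : Ideal D | M.IsMaximal ∧ I ≤ M}.Finite) ∧
    ∀ P : Ideal D, P.IsPrime → P ≠ ⊥ → ∃! M : Ideal D, M.IsMaximal ∧ P ≤ M

/-- GMPD (globalized multiplicatively pinched-Dedekind) domain: an h-local domain all of whose
localizations at maximal ideals are MPD domains. -/
def IsGMPDDomain (D : Type*) [CommRing D] [IsDomain D] : Prop :=
  IsHLocalDomain D ∧
    ∀ M : MaximalSpectrum D,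
      haveI : IsDomain (Localization.AtPrime M.asIdeal) :=
        IsLocalization.isDomain_localization M.asIdeal.primeCompl_le_nonZeroDivisors
      IsMPDDomain (Localization.AtPrime M.asIdeal)

/-- The overrings of a domain `D` with quotient field `K`: the subrings of `K` that contain `D`. -/
def overrings (D K : Type*) [CommRing D] [Field K] [Algebra D K] [IsFractionRing D K] :
    Set (Subring K) :=
  {R | (algebraMap D K).range ≤ R}

/-- The quasi-local overrings of `D`: those with exactly one maximal ideal. -/
def quasiLocalOverrings (D K : Type*) [CommRing D] [Field K] [Algebra D K]
    [IsFractionRing D K] : Set (Subring K) :=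
  {R | R ∈ overrings D K ∧ IsLocalRing R}

/-- The localization `D_M = {a / s | a ∈ D, s ∈ D \ M}` of a domain `D` at a maximal ideal `M`, as a
subring of the quotient field `K` of `D` (it again has quotient field `K`). -/
noncomputable abbrev localizationIn {D : Type*} (K : Type*) [CommRing D] [IsDomain D] [Field K]
    [Algebra D K] [IsFractionRing D K] (M : MaximalSpectrum D) : Subalgebra D K :=
  Localization.subalgebra.ofField K M.asIdeal.primeCompl
    M.asIdeal.primeCompl_le_nonZeroDivisors

/-! If `R` is a quasi-local overring, its maximal ideal contracts to a prime of `D` inside some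
maximal ideal `M`; elements of `D` outside `M` are then units of `R`, so `D_M ⊆ R`.

The converse rests on a divisibility property of a quasi-local MPD domain `A`: for `a ≠ 0`, either
`a ∣ b`, or `b ∣ a`, or `b² ∈ a(a, b)`. Put `y = a / b`, a nonzero element of an overring `R`. The
three cases give `y⁻¹ ∈ A`, `y ∈ A`, or `y⁻¹ = r y + s` with `r, s ∈ A`. Hence `y` or `1 - y` is a
unit of `R`.

Invertible ideals of `A` are principal, so the property reduces to the case where `(a, b)` is the
MNI ideal `Q`. There `Q² = jQ`, and each `q ∈ Q` satisfies `qQ = Q²` or `q ∈ Q²`; by Nakayama `a`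
and `b` are not both in `Q²`. -/

theorem Ideal.exists_eq_span_singleton_mul_of_le {A : Type*} [CommRing A] {I : Ideal A} {z : A}
    (h : I ≤ Ideal.span {z}) : ∃ I' : Ideal A, I = Ideal.span {z} * I' := by
  refine ⟨Submodule.comap (LinearMap.mulLeft A z) I, le_antisymm ?_ ?_⟩
  · intro x hx
    obtain ⟨c, rfl⟩ := Ideal.mem_span_singleton.1 (h hx)
    exact Ideal.mem_span_singleton_mul.2 ⟨c, hx, rfl⟩
  · intro x hx
    obtain ⟨c, hc, rfl⟩ := Ideal.mem_span_singleton_mul.1 hx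
    exact hc

theorem Ideal.eq_bot_of_le_mul_of_ne_top {A : Type*} [CommRing A] [IsLocalRing A]
    {I Q : Ideal A} (hQ : Q.FG) (hI : I ≠ ⊤) (h : Q ≤ I * Q) : Q = ⊥ :=
  Submodule.eq_bot_of_le_smul_of_le_jacobson_bot I Q hQ h
    ((IsLocalRing.le_maximalIdeal hI).trans (IsLocalRing.maximalIdeal_le_jacobson _))

section Invertible

variable {A : Type*} [CommRing A] [IsDomain A]

theorem isInvertibleIdeal_top : IsInvertibleIdeal (⊤ : Ideal A) := by
  simp [IsInvertibleIdeal]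

theorem isInvertibleIdeal_span_singleton {x : A} (hx : x ≠ 0) :
    IsInvertibleIdeal (Ideal.span {x}) := by
  rw [IsInvertibleIdeal, FractionalIdeal.coeIdeal_span_singleton]
  have hx' : algebraMap A (FractionRing A) x ≠ 0 := by simpa using hx
  refine .of_mul_eq_one (FractionalIdeal.spanSingleton _ (algebraMap A (FractionRing A) x)⁻¹) ?_
  rw [FractionalIdeal.spanSingleton_mul_spanSingleton, mul_inv_cancel₀ hx',
    FractionalIdeal.spanSingleton_one]

theorem isInvertibleIdeal_mul {I J : Ideal A} :
    IsInvertibleIdeal (I * J) ↔ IsInvertibleIdeal I ∧ IsInvertibleIdeal J := by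
  simp [IsInvertibleIdeal, FractionalIdeal.coeIdeal_mul]

theorem IsInvertibleIdeal.ne_bot {I : Ideal A} (h : IsInvertibleIdeal I) : I ≠ ⊥ := by
  rintro rfl
  simp [IsInvertibleIdeal] at h

theorem IsInvertibleIdeal.exists_eq_span_singleton [IsLocalRing A] {I : Ideal A}
    (h : IsInvertibleIdeal I) : ∃ x : A, x ≠ 0 ∧ I = Ideal.span {x} := by
  have hf : {M : Ideal A | M.IsMaximal}.Finite :=
    (Set.finite_singleton (IsLocalRing.maximalIdeal A)).subset
      fun M hM ↦ IsLocalRing.eq_maximalIdeal hM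
  obtain ⟨x, hx⟩ := Ideal.IsPrincipal.of_finite_maximals_of_isUnit hf h
  refine ⟨x, ?_, hx⟩
  rintro rfl
  exact h.ne_bot (by simpa using hx)

theorem IsMNIIdeal.ne_top {Q : Ideal A} (hQ : IsMNIIdeal Q) : Q ≠ ⊤ := by
  rintro rfl
  exact hQ.prop isInvertibleIdeal_top

/-- By maximality `Q + (x)` is invertible, hence some `(z)`, and `Q = zQ'` with `Q'` non-invertible
and containing `Q`. So `Q = zQ`, and Nakayama makes `z` a unit. In effect `Q` is the maximal ideal
of `A`. -/
theorem IsMNIIdeal.isUnit_of_notMem [IsLocalRing A] {Q : Ideal A} (hQ : IsMNIIdeal Q)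
    (h0 : Q ≠ ⊥) (hfg : Q.FG) {x : A} (hx : x ∉ Q) : IsUnit x := by
  have hlt : Q < Q ⊔ Ideal.span {x} := left_lt_sup.2 (by simpa using hx)
  obtain ⟨z, hz0, hz⟩ := (not_not.1 (hQ.not_prop_of_gt hlt)).exists_eq_span_singleton
  obtain ⟨Q', hQ'⟩ := Ideal.exists_eq_span_singleton_mul_of_le (hz ▸ hlt.le)
  have hQQ' : Q' = Q := by
    refine (hQ.eq_of_le (fun h ↦ hQ.prop ?_) ?_).symm
    · rw [hQ']
      exact isInvertibleIdeal_mul.2 ⟨isInvertibleIdeal_span_singleton hz0, h⟩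
    · exact hQ'.le.trans Ideal.mul_le_right
  rw [hQQ'] at hQ'
  by_cases hzt : Ideal.span {z} = ⊤
  · rw [hzt] at hz
    by_contra hxu
    refine (IsLocalRing.maximalIdeal.isMaximal A).ne_top (top_le_iff.1 (hz ▸ sup_le ?_ ?_))
    · exact IsLocalRing.le_maximalIdeal hQ.ne_top
    · exact (Ideal.span_singleton_le_iff_mem _).2 hxu
  · exact absurd (Ideal.eq_bot_of_le_mul_of_ne_top hfg hzt hQ'.le) h0

/-- The generators of a two-generated MNI ideal of a quasi-local MPD domain divide one another, or
satisfy a quadratic relation. -/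
theorem IsMNIIdeal.dvd_or_dvd_or_exists_sq_eq [IsLocalRing A] {a b : A}
    (hQ : IsMNIIdeal (Ideal.span {a, b})) (ha : a ≠ 0)
    (hmpd : ∀ I : Ideal A, I ≠ ⊥ → ¬ IsInvertibleIdeal I →
      ∃ J : Ideal A, IsInvertibleIdeal J ∧ I = J * Ideal.span {a, b}) :
    a ∣ b ∨ b ∣ a ∨ ∃ r s : A, b * b = a * (r * a + s * b) := by
  have haQ : a ∈ Ideal.span {a, b} := Ideal.subset_span (by simp)
  have hbQ : b ∈ Ideal.span {a, b} := Ideal.subset_span (by simp)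
  have hfg : (Ideal.span {a, b}).FG := Submodule.fg_span (Set.toFinite _)
  have hmem : ∀ {q : A}, q ∈ Ideal.span {a, b} → ∃ r s : A, r * a + s * b = q :=
    fun h ↦ Ideal.mem_span_pair.1 h
  have hle : ∀ {I : Ideal A}, a ∈ I → b ∈ I → Ideal.span {a, b} ≤ I :=
    fun ha hb ↦ Ideal.span_le.2 (by simp [Set.insert_subset_iff, ha, hb])
  generalize Ideal.span {a, b} = Q at *
  have h0 : Q ≠ ⊥ := by
    rintro rfl
    exact ha (by simpa using haQ)
  obtain ⟨J, hJ, hJQ⟩ := hmpd (Q * Q) (mul_ne_zero h0 h0)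
    fun h ↦ hQ.prop (isInvertibleIdeal_mul.1 h).1
  obtain ⟨j, hj0, rfl⟩ := hJ.exists_eq_span_singleton
  have hnotle : ¬ Q ≤ Q * Q := fun h ↦ h0 (Ideal.eq_bot_of_le_mul_of_ne_top hfg hQ.ne_top h)
  have hjQ : j ∈ Q := by
    by_contra hj
    rw [Ideal.span_singleton_eq_top.2 (hQ.isUnit_of_notMem h0 hfg hj), Ideal.top_mul] at hJQ
    exact hnotle hJQ.ge
  -- Since `qQ ≤ Q² = jQ ≤ (j)`, the MPD property gives `qQ = jcQ` for some `c`. If `c ∉ Q`, then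
  -- `c` is a unit and `qQ = jQ = Q²`. If `c ∈ Q`, cancelling `j` in `jq ∈ jcQ` gives `q ∈ cQ ≤ Q²`.
  have key : ∀ q ∈ Q, Ideal.span {q} * Q = Q * Q ∨ q ∈ Q * Q := by
    intro q hq
    rcases eq_or_ne q 0 with rfl | hq0
    · exact .inr (zero_mem _)
    have hqQ : Ideal.span {q} * Q ≤ Ideal.span {j} * Q :=
      hJQ ▸ Ideal.mul_mono_left ((Ideal.span_singleton_le_iff_mem _).2 hq)
    obtain ⟨I, hI⟩ := Ideal.exists_eq_span_singleton_mul_of_le (hqQ.trans Ideal.mul_le_left)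
    have hqQ0 : Ideal.span {q} * Q ≠ ⊥ := mul_ne_zero (by simpa using hq0) h0
    obtain ⟨C, hC, rfl⟩ := hmpd I (fun h ↦ hqQ0 (by rw [hI, h, Ideal.mul_bot])) fun h ↦
      hQ.prop (isInvertibleIdeal_mul.1
        (hI ▸ isInvertibleIdeal_mul.2 ⟨isInvertibleIdeal_span_singleton hj0, h⟩)).2
    obtain ⟨c, hc0, rfl⟩ := hC.exists_eq_span_singleton
    by_cases hc : c ∈ Q
    · right
      have hjq : j * q ∈ Ideal.span {j} * (Ideal.span {c} * Q) :=
        hI ▸ Ideal.mem_span_singleton_mul.2 ⟨j, hjQ, mul_comm _ _⟩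
      obtain ⟨w, hw, hwq⟩ := Ideal.mem_span_singleton_mul.1 hjq
      rw [← mul_left_cancel₀ hj0 hwq]
      exact Ideal.mul_mono_left ((Ideal.span_singleton_le_iff_mem _).2 hc) hw
    · left
      rw [hI, hJQ, Ideal.span_singleton_eq_top.2 (hQ.isUnit_of_notMem h0 hfg hc), Ideal.top_mul]
  rcases key a haQ with hA | hA
  · rcases key b hbQ with hB | hB
    · right; right
      have hbb : b * b ∈ Ideal.span {a} * Q := hA ▸ Ideal.mul_mem_mul hbQ hbQ
      obtain ⟨q, hq, hqb⟩ := Ideal.mem_span_singleton_mul.1 hbb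
      obtain ⟨r, s, rfl⟩ := hmem hq
      exact ⟨r, s, hqb.symm⟩
    · left
      obtain ⟨q, -, hq⟩ := Ideal.mem_span_singleton_mul.1 (hA ▸ hB)
      exact ⟨q, hq.symm⟩
  · rcases key b hbQ with hB | hB
    · right; left
      obtain ⟨q, -, hq⟩ := Ideal.mem_span_singleton_mul.1 (hB ▸ hA)
      exact ⟨q, hq.symm⟩
    · exact absurd (hle hA hB) hnotle

/-- All three alternatives survive multiplying `a` and `b` by a common factor. Dividing out the
generator of the invertible factor leaves a pair generating either `A`, where one member is a unit,
or the MNI ideal. -/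
theorem IsMPDDomain.dvd_or_dvd_or_exists_sq_eq [IsLocalRing A] (hA : IsMPDDomain A) {a b : A}
    (ha : a ≠ 0) : a ∣ b ∨ b ∣ a ∨ ∃ r s : A, b * b = a * (r * a + s * b) := by
  have haI : a ∈ Ideal.span {a, b} := Ideal.subset_span (by simp)
  have hbI : b ∈ Ideal.span {a, b} := Ideal.subset_span (by simp)
  have h0 : Ideal.span {a, b} ≠ ⊥ := fun h ↦ ha (by simpa [h] using haI)
  by_cases hI : IsInvertibleIdeal (Ideal.span {a, b})
  · obtain ⟨c, hc0, hc⟩ := hI.exists_eq_span_singleton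
    obtain ⟨a', rfl⟩ := Ideal.mem_span_singleton.1 (hc ▸ haI)
    obtain ⟨b', rfl⟩ := Ideal.mem_span_singleton.1 (hc ▸ hbI)
    obtain ⟨r, s, hrs⟩ := Ideal.mem_span_pair.1 (hc ▸ Ideal.mem_span_singleton_self c)
    have hrs1 : r * a' + s * b' = 1 := mul_left_cancel₀ hc0 (by linear_combination hrs)
    rcases IsLocalRing.isUnit_or_isUnit_of_add_one hrs1 with h | h
    · exact .inl (mul_dvd_mul_left c (isUnit_of_mul_isUnit_right h).dvd)
    · exact .inr (.inl (mul_dvd_mul_left c (isUnit_of_mul_isUnit_right h).dvd))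
  · obtain ⟨Q, hQ, -, hmpd⟩ := hA
    obtain ⟨J, hJ, hJQ⟩ := hmpd _ h0 hI
    obtain ⟨j, hj0, rfl⟩ := hJ.exists_eq_span_singleton
    obtain ⟨a', -, rfl⟩ := Ideal.mem_span_singleton_mul.1 (hJQ ▸ haI)
    obtain ⟨b', -, rfl⟩ := Ideal.mem_span_singleton_mul.1 (hJQ ▸ hbI)
    have hspan : Ideal.span {j * a', j * b'} = Ideal.span {j} * Ideal.span {a', b'} := by
      rw [Ideal.span_mul_span', Set.singleton_mul, Set.image_pair]
    rw [hspan, Ideal.span_singleton_mul_right_inj hj0] at hJQ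
    subst hJQ
    rcases hQ.dvd_or_dvd_or_exists_sq_eq (right_ne_zero_of_mul ha) hmpd with h | h | ⟨r, s, h⟩
    · exact .inl (mul_dvd_mul_left j h)
    · exact .inr (.inl (mul_dvd_mul_left j h))
    · exact .inr (.inr ⟨r, s, by linear_combination j * j * h⟩)

/-- Every overring of a quasi-local MPD domain is quasi-local. -/
theorem IsMPDDomain.isLocalRing_of_range_le [IsLocalRing A] (hA : IsMPDDomain A) {K : Type*}
    [Field K] (f : A →+* K) (hf : ∀ y : K, ∃ a b : A, y = f a / f b) {R : Subring K}
    (hR : f.range ≤ R) : IsLocalRing R := by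
  have hmem : ∀ c, f c ∈ R := fun c ↦ hR ⟨c, rfl⟩
  have hunit : ∀ y : R, (y : K) ≠ 0 → (y : K)⁻¹ ∈ R → IsUnit y := fun y h0 h ↦
    .of_mul_eq_one ⟨_, h⟩ (Subtype.ext (mul_inv_cancel₀ h0))
  refine .of_isUnit_or_isUnit_one_sub_self fun y ↦ ?_
  rcases eq_or_ne y 0 with rfl | hy0
  · simp
  have hy0' : (y : K) ≠ 0 := by simpa using hy0
  obtain ⟨a, b, hab⟩ := hf y
  have ha : f a ≠ 0 := by rintro h; simp [hab, h] at hy0'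
  have hb : f b ≠ 0 := by rintro h; simp [hab, h] at hy0'
  rcases hA.dvd_or_dvd_or_exists_sq_eq (a := a) (b := b) (by rintro rfl; simp at ha) with
    ⟨c, rfl⟩ | ⟨c, rfl⟩ | ⟨r, s, h⟩
  · refine .inl (hunit y hy0' ?_)
    rw [hab, inv_div, map_mul, mul_div_cancel_left₀ _ ha]
    exact hmem c
  · rw [map_mul, mul_div_cancel_left₀ _ hb] at hab
    obtain rfl : y = f.codRestrict R hmem c := Subtype.ext hab
    rw [← map_one (f.codRestrict R hmem), ← map_sub]
    exact (IsLocalRing.isUnit_or_isUnit_one_sub_self c).imp (.map _) (.map _)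
  · refine .inl (hunit y hy0' ?_)
    -- Divide `b² = a(ra + sb)` by `ab`.
    have : (y : K)⁻¹ = f r * y + f s := by
      have h' := congrArg f h
      simp only [map_mul, map_add] at h'
      rw [hab]
      field_simp
      linear_combination h'
    rw [this]
    exact add_mem (mul_mem (hmem r) y.2) (hmem s)

end Invertible

theorem mem_localizationIn {D K : Type*} [CommRing D] [IsDomain D] [Field K] [Algebra D K]
    [IsFractionRing D K] {M : MaximalSpectrum D} {x : K} : x ∈ localizationIn K M ↔
      ∃ a s : D, s ∉ M.asIdeal ∧ x = algebraMap D K a * (algebraMap D K s)⁻¹ :=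
  ⟨fun ⟨a, s, hs, h⟩ ↦ ⟨a, s, hs, h⟩, fun ⟨a, s, hs, h⟩ ↦ ⟨a, s, hs, h⟩⟩

theorem mem_overrings_localizationIn {D K : Type*} [CommRing D] [IsDomain D] [Field K] [Algebra D K]
    [IsFractionRing D K] {M : MaximalSpectrum D} {R : Subring K} :
    R ∈ overrings (localizationIn K M) K ↔ ∀ x ∈ localizationIn K M, x ∈ R :=
  ⟨fun h x hx ↦ h ⟨⟨x, hx⟩, rfl⟩, by rintro h _ ⟨x, rfl⟩; exact h x x.2⟩

theorem lemma2p4 {D K : Type*} [CommRing D] [IsDomain D] [Field K] [Algebra D K]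
    [IsFractionRing D K] (hD : IsGMPDDomain D) :
    quasiLocalOverrings D K = ⋃ M : MaximalSpectrum D, overrings (localizationIn K M) K := by
  ext R
  simp only [Set.mem_iUnion, mem_overrings_localizationIn]
  constructor
  · rintro ⟨hDR, hloc⟩
    let g : D →+* R := (algebraMap D K).codRestrict R fun x ↦ hDR ⟨x, rfl⟩
    -- The contraction is only known to be prime, so `M` is any maximal ideal above it.
    obtain ⟨M, hM, hPM⟩ := Ideal.exists_le_maximal _
      (Ideal.IsPrime.ne_top (I := (IsLocalRing.maximalIdeal R).comap g) inferInstance)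
    refine ⟨⟨M, hM⟩, fun x hx ↦ ?_⟩
    obtain ⟨a, s, hs, rfl⟩ := mem_localizationIn.1 hx
    have hsu : IsUnit (g s) := by
      by_contra h
      exact hs (hPM h)
    obtain ⟨u, hu⟩ := hsu.exists_right_inv
    have hu' : algebraMap D K s * u = 1 := congrArg Subtype.val hu
    rw [inv_eq_of_mul_eq_one_right hu']
    exact mul_mem (g a).2 u.2
  · rintro ⟨M, hR⟩
    refine ⟨?_, ?_⟩
    · rintro _ ⟨x, rfl⟩
      exact hR _ (algebraMap_mem _ x)
    · have : IsDomain (Localization.AtPrime M.asIdeal) :=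
        IsLocalization.isDomain_localization M.asIdeal.primeCompl_le_nonZeroDivisors
      let e : Localization.AtPrime M.asIdeal ≃ₐ[D] localizationIn K M :=
        IsLocalization.algEquiv M.asIdeal.primeCompl _ _
      refine (hD.2 M).isLocalRing_of_range_le
        ((localizationIn K M).subtype.comp e.toRingEquiv.toRingHom) (fun y ↦ ?_) ?_
      · obtain ⟨a, b, -, h⟩ := IsFractionRing.div_surjective (A := D) y
        refine ⟨algebraMap _ _ a, algebraMap _ _ b, h.symm.trans ?_⟩
        simp [e]
        rfl
      · rintro _ ⟨x, rfl⟩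
        exact hR _ (e x).2
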